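/- Let $d,s\ge 1$, let $G\subset\mathbb{R}^d$ be a bounded, Borel measurable set, and let $\pi$ be a probability measure on $(G,\mathcal{B}(G))$. Let $\mathscr{B}=\{(-\infty,y)\cap G : y\in\mathbb{R}^d\}$, where $(-\infty,y)=\prod_{j=1}^d(-\infty,y_j)$, be the set of anchored boxes intersected with $G$. For points $x_1,\dots,x_n\in G$ (repetitions allowed) put $$D^*_{\mathscr{B},\pi}(x_1,\dots,x_n)=\sup_{A\in\mathscr{B}}\left|\frac1n\sum_{i=1}^n 1_{x_i\in A}-\pi(A)\right|.$$ Let $K$ be a transition kernel on $(G,\mathcal{B}(G))$ and let $\varphi\colon G\times[0,1]^s\to G$ be an update function of $K$, that is, $\varphi$ is measurable and $K(x,A)=\lambda_s(\{u\in[0,1]^s:\varphi(x;u)\in A\})$ for all $x\in G$ and $A\in\mathcal{B}(G)$, where $\lambda_s$ is the Lebesgue measure. Assume that $\varphi$ satisfies the anywhere-to-anywhere condition: for all $x,y\in G$ there is a $u\in[0,1]^s$ with $\varphi(x;u)=y$. Let $\psi\colon[0,1]^s\to G$ be any surjective function. Then for every integer $n\ge 1$ there exists a driver sequence $u_0,u_1,\dots,u_{n-1}\in[0,1]^s$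 such that the points given by $x_1=\psi(u_0)$ and $x_{i+1}=\varphi(x_i;u_i)$ for $i=1,\dots,n-1$ satisfy $$D^*_{\mathscr{B},\pi}(x_1,\dots,x_n)\le 63\sqrt d\,\frac{(2+\log_2 n)^{(3d+1)/2}}{n}.$$ -/

import Mathlib

open MeasureTheory ProbabilityTheory

/-- The unit cube `[0,1]^s`. Its `volume` (product of the Lebesgue measures on `[0,1]`) is the
uniform distribution on `[0,1]^s`. -/
abbrev UnitCube (s : ℕ) : Type := Fin s → unitInterval

/-- `φ : G × [0,1]^s → G` is an update function of the transition kernel `K`: it is measurable, and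
`K(x, A)` is the Lebesgue measure of `{u ∈ [0,1]^s | φ(x; u) ∈ A}`, for all `x ∈ G` and all
measurable `A ⊆ G`. -/
def IsUpdateFunction {G : Type*} [MeasurableSpace G] {s : ℕ} (K : Kernel G G)
    (φ : G → UnitCube s → G) : Prop :=
  Measurable (fun p : G × UnitCube s => φ p.1 p.2) ∧
    ∀ (x : G) (A : Set G), MeasurableSet A → K x A = volume {u : UnitCube s | φ x u ∈ A}

/-- Every state can be reached from every state in one step. -/
def AnywhereToAnywhere {G : Type*} {s : ℕ} (φ : G → UnitCube s → G) : Prop :=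
  ∀ x y : G, ∃ u : UnitCube s, φ x u = y

/-- The state produced from the driver sequence `u_0, …, u_{n-1}` with index `i`, counted from `0`:
the initial state is `ψ(u_0)`, and the state with index `i + 1` is `φ(x; u_{i+1})`, where `x` is the
state with index `i`. -/
def drivenState {G : Type*} {s : ℕ} (φ : G → UnitCube s → G) (ψ : UnitCube s → G) {n : ℕ}
    (u : Fin n → UnitCube s) : (i : ℕ) → i < n → G
  | 0, h => ψ (u ⟨0, h⟩)
  | i + 1, h => φ (drivenState φ ψ u i (Nat.lt_of_succ_lt h)) (u ⟨i + 1, h⟩)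

/-- The `n` points `x_1 = ψ(u_0)`, `x_{i+1} = φ(x_i; u_i)` (`1 ≤ i ≤ n - 1`), where `x_{i+1}` is the
value at the index `i : Fin n`. -/
def drivenPoints {G : Type*} {s : ℕ} (φ : G → UnitCube s → G) (ψ : UnitCube s → G) {n : ℕ}
    (u : Fin n → UnitCube s) : Fin n → G :=
  fun i => drivenState φ ψ u i.1 i.2

/-- The star-discrepancy `sup_{A ∈ 𝒜} |(1/n) ∑_i 1_{x_i ∈ A} - π(A)|`. For a probability measure `π`
each of these numbers is at most `1`, so that the supremum of reals is a genuine one. -/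
noncomputable def starDiscrepancy {G : Type*} [MeasurableSpace G] (𝒜 : Set (Set G))
    (π : Measure G) {n : ℕ} (x : Fin n → G) : ℝ :=
  ⨆ A : 𝒜, |(1 / (n : ℝ)) * ∑ i, (A : Set G).indicator (fun _ => (1 : ℝ)) (x i) - π.real (A : Set G)|

/-- The sets `(-∞, y) ∩ G` with `y ∈ ℝ^d`, where `(-∞, y) = ∏_j (-∞, y_j)`, as subsets of `G`. -/
def anchoredBoxes {d : ℕ} (G : Set (Fin d → ℝ)) : Set (Set G) :=
  {A | ∃ y : Fin d → ℝ, A = {g : G | ∀ j, (g : Fin d → ℝ) j < y j}}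

/-!
Under the anywhere-to-anywhere condition every finite sequence of points is driven by some
`u`, so the claim is about the best `n` points for the boxes.

Each coordinate axis is cut into at most `2n + 1` intervals, each of which is a single point or has
mass at most `1 / n`, so that every box is squeezed between two boxes of grid cells whose masses
differ by at most `d / n`. It remains to round the cell weights `n π(c)` to integers with a small
error on each box of cells. Writing the rounding errors as signs, this is a vector balancing
problem: by comparing the binary digits of two indices, the indicator of `i < a` for
`i, a < 2 ^ k` is an inner product of two vectors of norm at most `√k`, hence the indicator of a
box of cells is an inner product of two tensors of norm at most `k ^ (d / 2)`. The Gram–Schmidt walk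
of Bansal, Dadush, Garg and Lovett balances the signs so that every inner product is subgaussian,
and a union bound over the `2 ^ (k d)` boxes finishes the proof. No probability space is needed: the
functions that dominate the moment generating function of some choice of random signs form a convex
set, and a step of the walk writes fractional signs as a convex combination of two others.
-/

section SignMgf

theorem le_tangent_of_antitone_deriv {f f' : ℝ → ℝ} (hf : ∀ x, HasDerivAt f (f' x) x)
    (hf' : Antitone f') (x y : ℝ) : f y ≤ f x + f' x * (y - x) := by
  have hdiff : Differentiable ℝ f := fun z => (hf z).differentiableAt
  have hconc : ConcaveOn ℝ Set.univ f := by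
    refine Antitone.concaveOn_univ_of_deriv hdiff ?_
    rwa [show deriv f = f' from funext fun z => (hf z).deriv]
  rcases lt_trichotomy x y with h | rfl | h
  · have := hconc.slope_le_of_hasDerivAt (Set.mem_univ x) (Set.mem_univ y) h (hf x)
    rw [slope_def_field, div_le_iff₀ (sub_pos.2 h)] at this
    linarith
  · simp
  · have := hconc.le_slope_of_hasDerivAt (Set.mem_univ y) (Set.mem_univ x) h (hf x)
    rw [slope_def_field, le_div_iff₀ (sub_pos.2 h)] at this
    linarith

/-- The moment generating function of a random sign with mean `t`, at the point `x`. -/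
noncomputable def signMgf (t x : ℝ) : ℝ :=
  Real.cosh x + t * Real.sinh x

/-- The logarithmic derivative of `signMgf t`: the mean of the random sign after exponential tilting
by `x`. -/
noncomputable def tiltedMean (t x : ℝ) : ℝ :=
  (Real.sinh x + t * Real.cosh x) / signMgf t x

theorem tiltedMean_zero (t : ℝ) : tiltedMean t 0 = t := by
  simp [tiltedMean, signMgf]

theorem hasDerivAt_signMgf (t x : ℝ) :
    HasDerivAt (signMgf t) (Real.sinh x + t * Real.cosh x) x :=
  (Real.hasDerivAt_cosh x).add ((Real.hasDerivAt_sinh x).const_mul t)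

variable {t : ℝ}

theorem signMgf_pos (ht : |t| ≤ 1) (x : ℝ) : 0 < signMgf t x := by
  have hle : |t * Real.sinh x| ≤ |Real.sinh x| := by
    rw [abs_mul]
    exact mul_le_of_le_one_left (abs_nonneg _) ht
  have hlt : |Real.sinh x| < Real.cosh x := by
    rw [Real.abs_sinh, ← Real.cosh_abs]
    exact Real.sinh_lt_cosh |x|
  unfold signMgf
  linarith [neg_abs_le (t * Real.sinh x)]

theorem hasDerivAt_tiltedMean (ht : |t| ≤ 1) (x : ℝ) :
    HasDerivAt (tiltedMean t) ((1 - t ^ 2) / signMgf t x ^ 2) x := by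
  have hnum : HasDerivAt (fun x => Real.sinh x + t * Real.cosh x) (signMgf t x) x :=
    (Real.hasDerivAt_sinh x).add ((Real.hasDerivAt_cosh x).const_mul t)
  refine (hnum.div (hasDerivAt_signMgf t x) (signMgf_pos ht x).ne').congr_deriv ?_
  congr 1
  unfold signMgf
  linear_combination (1 - t ^ 2) * Real.cosh_sq_sub_sinh_sq x

theorem monotone_tiltedMean (ht : |t| ≤ 1) : Monotone (tiltedMean t) := by
  refine monotone_of_hasDerivAt_nonneg (hasDerivAt_tiltedMean ht) fun x => ?_
  have : t ^ 2 ≤ 1 := (sq_le_one_iff_abs_le_one t).2 ht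
  exact div_nonneg (by linarith) (sq_nonneg _)

theorem antitone_tiltedMean_sub_self (ht : |t| ≤ 1) : Antitone fun x => tiltedMean t x - x := by
  refine antitone_of_hasDerivAt_nonpos
    (fun x => (hasDerivAt_tiltedMean ht x).sub (hasDerivAt_id x)) fun x => ?_
  have hvar : 1 - t ^ 2 ≤ signMgf t x ^ 2 := by
    unfold signMgf
    nlinarith [sq_nonneg (Real.sinh x + t * Real.cosh x), Real.cosh_sq_sub_sinh_sq x]
  exact sub_nonpos.2 (div_le_one_of_le₀ hvar (sq_nonneg _))

theorem tiltedMean_sub_mul_le (ht : |t| ≤ 1) (a b : ℝ) :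
    (tiltedMean t a - t - a) * b ≤ max 0 (-(a * b)) := by
  rcases le_total 0 a with ha | ha
  · have hlow : t ≤ tiltedMean t a := by simpa [tiltedMean_zero] using monotone_tiltedMean ht ha
    have hupp : tiltedMean t a - a ≤ t := by
      simpa [tiltedMean_zero] using antitone_tiltedMean_sub_self ht ha
    rcases le_total 0 b with hb | hb
    · exact le_max_of_le_left (mul_nonpos_of_nonpos_of_nonneg (by linarith) hb)
    · exact le_max_of_le_right (by nlinarith)
  · have hlow : tiltedMean t a ≤ t := by simpa [tiltedMean_zero] using monotone_tiltedMean ht ha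
    have hupp : t ≤ tiltedMean t a - a := by
      simpa [tiltedMean_zero] using antitone_tiltedMean_sub_self ht ha
    rcases le_total 0 b with hb | hb
    · exact le_max_of_le_right (by nlinarith)
    · exact le_max_of_le_left (mul_nonpos_of_nonneg_of_nonpos (by linarith) hb)

/-- The moment generating function at `a` of a centred random sign whose mean was `t`, divided by
that of a standard Gaussian variable. -/
noncomputable def pivotFactor (a t : ℝ) : ℝ :=
  Real.exp (-(a ^ 2 / 2) - a * t) * signMgf t a

theorem pivotFactor_pos (ht : |t| ≤ 1) (a : ℝ) : 0 < pivotFactor a t :=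
  mul_pos (Real.exp_pos _) (signMgf_pos ht a)

theorem pivotFactor_zero (t : ℝ) : pivotFactor 0 t = 1 := by
  simp [pivotFactor, signMgf]

theorem hasDerivAt_log_pivotFactor (ht : |t| ≤ 1) (a : ℝ) :
    HasDerivAt (fun a => Real.log (pivotFactor a t)) (tiltedMean t a - t - a) a := by
  have hlog : (fun a => Real.log (pivotFactor a t)) =
      fun a => Real.log (signMgf t a) - a * t - a ^ 2 / 2 := by
    funext a
    rw [pivotFactor, Real.log_mul (Real.exp_ne_zero _) (signMgf_pos ht a).ne', Real.log_exp]
    ring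
  rw [hlog]
  refine ((((hasDerivAt_signMgf t a).log (signMgf_pos ht a).ne').sub
    ((hasDerivAt_id a).mul_const t)).sub (((hasDerivAt_id a).pow 2).div_const 2)).congr_deriv ?_
  simp [tiltedMean]

theorem pivotFactor_add_le (ht : |t| ≤ 1) (a b : ℝ) :
    pivotFactor (a + b) t ≤ pivotFactor a t * Real.exp (max 0 (-(a * b))) := by
  have hanti : Antitone fun a => tiltedMean t a - t - a := fun x y hxy => by
    linarith [antitone_tiltedMean_sub_self ht hxy]
  have htangent := le_tangent_of_antitone_deriv (hasDerivAt_log_pivotFactor ht) hanti a (a + b)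
  rw [add_sub_cancel_left] at htangent
  rw [← Real.log_le_log_iff (pivotFactor_pos ht _)
    (mul_pos (pivotFactor_pos ht a) (Real.exp_pos _)),
    Real.log_mul (pivotFactor_pos ht a).ne' (Real.exp_ne_zero _), Real.log_exp]
  linarith [tiltedMean_sub_mul_le ht a b]

theorem pivotFactor_le_one (ht : |t| ≤ 1) (a : ℝ) : pivotFactor a t ≤ 1 := by
  simpa [pivotFactor_zero] using pivotFactor_add_le ht 0 a

theorem pivotFactor_of_abs_eq_one (ht : |t| = 1) (a : ℝ) :
    pivotFactor a t = Real.exp (-(a ^ 2 / 2)) := by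
  rcases eq_or_eq_neg_of_abs_eq ht with rfl | rfl
  · rw [pivotFactor, signMgf, one_mul, Real.cosh_add_sinh, ← Real.exp_add]
    congr 1
    ring
  · rw [pivotFactor, signMgf, neg_one_mul, ← sub_eq_add_neg, Real.cosh_sub_sinh, ← Real.exp_add]
    congr 1
    ring

theorem exp_mul_pivotFactor_add (a t δ : ℝ) :
    Real.exp (δ * a) * pivotFactor a (t + δ) =
      pivotFactor a t + δ * (Real.exp (-(a ^ 2 / 2) - a * t) * Real.sinh a) := by
  have hexp : Real.exp (δ * a) * Real.exp (-(a ^ 2 / 2) - a * (t + δ)) =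
      Real.exp (-(a ^ 2 / 2) - a * t) := by
    rw [← Real.exp_add]
    congr 1
    ring
  rw [pivotFactor, ← mul_assoc, hexp, pivotFactor, signMgf, signMgf]
  ring

end SignMgf

section Projection

variable {E : Type*} [NormedAddCommGroup E] [InnerProductSpace ℝ E]

theorem norm_sq_starProjection_le_of_le {U V : Submodule ℝ E} [U.HasOrthogonalProjection]
    [V.HasOrthogonalProjection] (h : U ≤ V) (θ : E) :
    ‖U.starProjection θ‖ ^ 2 ≤ ‖V.starProjection θ‖ ^ 2 := by
  rw [← Submodule.starProjection_comp_starProjection_of_le h]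
  gcongr
  exact Submodule.norm_starProjection_apply_le _ _

theorem inner_sq_le_mul_norm_sq_starProjection_sub {U V : Submodule ℝ E}
    [U.HasOrthogonalProjection] [V.HasOrthogonalProjection] (h : U ≤ V) (θ : E) {z : E}
    (hzV : z ∈ V) (hzU : z ∈ Uᗮ) :
    inner ℝ θ z ^ 2 ≤ ‖z‖ ^ 2 * (‖V.starProjection θ‖ ^ 2 - ‖U.starProjection θ‖ ^ 2) := by
  have hU : U.starProjection (V.starProjection θ) = U.starProjection θ :=
    DFunLike.congr_fun (Submodule.starProjection_comp_starProjection_of_le h) θ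
  have hinner : inner ℝ θ z = inner ℝ (Uᗮ.starProjection (V.starProjection θ)) z := by
    rw [Submodule.inner_starProjection_left_eq_right,
      Submodule.starProjection_eq_self_iff.2 hzU, Submodule.inner_starProjection_left_eq_right,
      Submodule.starProjection_eq_self_iff.2 hzV]
  have hnorm : ‖Uᗮ.starProjection (V.starProjection θ)‖ ^ 2 =
      ‖V.starProjection θ‖ ^ 2 - ‖U.starProjection θ‖ ^ 2 := by
    rw [Submodule.norm_sq_eq_add_norm_sq_starProjection (V.starProjection θ) U, hU]
    ring
  rw [hinner, ← hnorm, mul_comm, ← mul_pow]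
  exact sq_le_sq.2 ((abs_real_inner_le_norm _ _).trans (le_abs_self _))

theorem neg_inner_mul_inner_le {U V : Submodule ℝ E} [U.HasOrthogonalProjection]
    [V.HasOrthogonalProjection] (h : U ≤ V) {w g : E} (hw : w ∈ V) (hg : g ∈ V)
    (hwg : inner ℝ w g = 0) (hnorm : ‖w + g‖ ≤ 1) (hU : ‖g‖ ^ 2 • w - ‖w‖ ^ 2 • g ∈ Uᗮ) (θ : E) :
    -(inner ℝ θ w * inner ℝ θ g) ≤
      (‖V.starProjection θ‖ ^ 2 - ‖U.starProjection θ‖ ^ 2) / 2 := by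
  have hmono := norm_sq_starProjection_le_of_le h θ
  rcases eq_or_ne w 0 with rfl | hw0
  · simpa using div_nonneg (sub_nonneg.2 hmono) zero_le_two
  rcases eq_or_ne g 0 with rfl | hg0
  · simpa using div_nonneg (sub_nonneg.2 hmono) zero_le_two
  have hsum : ‖w‖ ^ 2 + ‖g‖ ^ 2 ≤ 1 := by
    have := norm_add_sq_eq_norm_sq_add_norm_sq_real hwg
    nlinarith [norm_nonneg (w + g)]
  have hz : ‖‖g‖ ^ 2 • w - ‖w‖ ^ 2 • g‖ ^ 2 = ‖w‖ ^ 2 * ‖g‖ ^ 2 * (‖w‖ ^ 2 + ‖g‖ ^ 2) := by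
    rw [norm_sub_sq_real, inner_smul_left, inner_smul_right, hwg, norm_smul, norm_smul,
      Real.norm_of_nonneg (sq_nonneg ‖g‖), Real.norm_of_nonneg (sq_nonneg ‖w‖)]
    ring
  have hproj := inner_sq_le_mul_norm_sq_starProjection_sub h θ
    (V.sub_mem (V.smul_mem _ hw) (V.smul_mem _ hg)) hU
  rw [hz, inner_sub_right, inner_smul_right, inner_smul_right] at hproj
  set Δ := ‖V.starProjection θ‖ ^ 2 - ‖U.starProjection θ‖ ^ 2
  have hΔ : 0 ≤ Δ := sub_nonneg.2 hmono
  have hsγ : 0 < ‖w‖ ^ 2 * ‖g‖ ^ 2 := by positivity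
  have hbound : ‖w‖ ^ 2 * ‖g‖ ^ 2 * (‖w‖ ^ 2 + ‖g‖ ^ 2) * Δ ≤ ‖w‖ ^ 2 * ‖g‖ ^ 2 * Δ := by
    rw [mul_assoc]
    exact mul_le_mul_of_nonneg_left (mul_le_of_le_one_left hΔ hsum) hsγ.le
  refine le_of_mul_le_mul_left ?_ hsγ
  nlinarith [sq_nonneg (‖g‖ ^ 2 * inner ℝ θ w + ‖w‖ ^ 2 * inner ℝ θ g)]

theorem starProjection_orthogonal_mem_sup_span (W : Submodule ℝ E) [W.HasOrthogonalProjection]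
    (v : E) : Wᗮ.starProjection v ∈ W ⊔ Submodule.span ℝ {v} := by
  rw [Submodule.starProjection_orthogonal_val]
  exact Submodule.sub_mem _ (Submodule.mem_sup_right (Submodule.mem_span_singleton_self v))
    (Submodule.mem_sup_left (Submodule.starProjection_apply_mem _ _))

theorem neg_inner_starProjection_mul_le {W W' : Submodule ℝ E} [FiniteDimensional ℝ W]
    [FiniteDimensional ℝ W'] (hW : W' ≤ W) {v : E} (hv : ‖v‖ ≤ 1) (θ : E) :
    -(inner ℝ θ (Wᗮ.starProjection v) *
        inner ℝ θ (W'ᗮ.starProjection v - Wᗮ.starProjection v)) ≤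
      (‖(W ⊔ Submodule.span ℝ {v}).starProjection θ‖ ^ 2 -
        ‖(W' ⊔ Submodule.span ℝ {v}).starProjection θ‖ ^ 2) / 2 := by
  set w := Wᗮ.starProjection v with hw
  set g := W'ᗮ.starProjection v - w with hg
  have hsum : w + g = W'ᗮ.starProjection v := add_sub_cancel _ _
  have hgW : g ∈ W := by
    rw [hg, hw, Submodule.starProjection_orthogonal_val, Submodule.starProjection_orthogonal_val,
      sub_sub_sub_cancel_left]
    exact W.sub_mem (Submodule.starProjection_apply_mem _ _)
      (hW (Submodule.starProjection_apply_mem _ _))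
  have hwW : w ∈ Wᗮ := Submodule.starProjection_apply_mem _ _
  have hwW' : w ∈ W'ᗮ := Submodule.orthogonal_le hW hwW
  have hgW' : g ∈ W'ᗮ := W'ᗮ.sub_mem (Submodule.starProjection_apply_mem _ _) hwW'
  have horth : inner ℝ w g = 0 := Submodule.inner_left_of_mem_orthogonal hgW hwW
  have hnorm : ‖w + g‖ ≤ 1 := hsum ▸ (Submodule.norm_starProjection_apply_le _ _).trans hv
  have hzW' : ‖g‖ ^ 2 • w - ‖w‖ ^ 2 • g ∈ W'ᗮ :=
    W'ᗮ.sub_mem (W'ᗮ.smul_mem _ hwW') (W'ᗮ.smul_mem _ hgW')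
  have hzv : inner ℝ v (‖g‖ ^ 2 • w - ‖w‖ ^ 2 • g) = 0 := by
    rw [← Submodule.starProjection_eq_self_iff.2 hzW',
      ← Submodule.inner_starProjection_left_eq_right, ← hsum]
    simp only [inner_sub_right, inner_smul_right, inner_add_left, horth, real_inner_comm w g,
      real_inner_self_eq_norm_sq]
    ring
  have hz : ‖g‖ ^ 2 • w - ‖w‖ ^ 2 • g ∈ (W' ⊔ Submodule.span ℝ {v})ᗮ := by
    rw [← Submodule.inf_orthogonal]
    exact ⟨hzW', Submodule.mem_orthogonal_singleton_iff_inner_right.2 hzv⟩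
  exact neg_inner_mul_inner_le (sup_le_sup_right hW _)
    (starProjection_orthogonal_mem_sup_span W v) (Submodule.mem_sup_left hgW) horth hnorm hz θ

/-- The contribution to `walkPotential` of the pivot vector `v`, whose sign currently has mean `t`,
where `W` is the span of the other active vectors. -/
noncomputable def walkFactor (W : Submodule ℝ E) [FiniteDimensional ℝ W] (v θ : E) (t : ℝ) : ℝ :=
  Real.exp (‖(W ⊔ Submodule.span ℝ {v}).starProjection θ‖ ^ 2 / 2) *
    pivotFactor (inner ℝ θ (Wᗮ.starProjection v)) t

variable (W : Submodule ℝ E) [FiniteDimensional ℝ W] {v : E} {t : ℝ}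

theorem walkFactor_le (v θ : E) (ht : |t| ≤ 1) :
    walkFactor W v θ t ≤ Real.exp (‖(W ⊔ Submodule.span ℝ {v}).starProjection θ‖ ^ 2 / 2) :=
  mul_le_of_le_one_right (Real.exp_pos _).le (pivotFactor_le_one ht _)

theorem exp_le_walkFactor (hv : ‖v‖ ≤ 1) (θ : E) (ht : |t| = 1) :
    Real.exp (‖W.starProjection θ‖ ^ 2 / 2) ≤ walkFactor W v θ t := by
  have hW : W ≤ W ⊔ Submodule.span ℝ {v} := le_sup_left
  have hinner := inner_sq_le_mul_norm_sq_starProjection_sub hW θ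
    (starProjection_orthogonal_mem_sup_span W v) (Submodule.starProjection_apply_mem _ _)
  have hnorm : ‖Wᗮ.starProjection v‖ ^ 2 ≤ 1 :=
    pow_le_one₀ (norm_nonneg _) ((Submodule.norm_starProjection_apply_le _ _).trans hv)
  rw [walkFactor, pivotFactor_of_abs_eq_one ht, ← Real.exp_add, Real.exp_le_exp]
  nlinarith [norm_sq_starProjection_le_of_le hW θ]

theorem walkFactor_mono {W W' : Submodule ℝ E} [FiniteDimensional ℝ W] [FiniteDimensional ℝ W']
    (hW : W' ≤ W) (hv : ‖v‖ ≤ 1) (θ : E) (ht : |t| ≤ 1) :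
    walkFactor W' v θ t ≤ walkFactor W v θ t := by
  have hproj : ‖(W' ⊔ Submodule.span ℝ {v}).starProjection θ‖ ^ 2 ≤
      ‖(W ⊔ Submodule.span ℝ {v}).starProjection θ‖ ^ 2 :=
    norm_sq_starProjection_le_of_le (sup_le_sup_right hW _) θ
  have hpivot := pivotFactor_add_le ht (inner ℝ θ (Wᗮ.starProjection v))
    (inner ℝ θ (W'ᗮ.starProjection v - Wᗮ.starProjection v))
  rw [← inner_add_right, add_sub_cancel] at hpivot
  have hmax := max_le (div_nonneg (sub_nonneg.2 hproj) zero_le_two)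
    (neg_inner_starProjection_mul_le hW hv θ)
  refine (mul_le_mul_of_nonneg_left (hpivot.trans (mul_le_mul_of_nonneg_left
    (Real.exp_le_exp.2 hmax) (pivotFactor_pos ht _).le)) (Real.exp_pos _).le).trans_eq ?_
  rw [walkFactor, sub_div, Real.exp_sub]
  field_simp

end Projection

section GramSchmidtWalk

theorem exists_boundary_step {ι : Type*} {A : Finset ι} {p : ι} (hp : p ∈ A) {x u : ι → ℝ}
    (hx : ∀ i ∈ A, |x i| ≤ 1) (hu : u p ≠ 0) :
    ∃ δ : ℝ, 0 ≤ δ ∧ (∀ i ∈ A, |x i + δ * u i| ≤ 1) ∧ ∃ i ∈ A, |x i + δ * u i| = 1 := by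
  set maxAbs : ℝ → ℝ := fun δ => A.sup' ⟨p, hp⟩ fun i => |x i + δ * u i|
  have hcont : Continuous maxAbs :=
    Continuous.finset_sup'_apply _ fun i _ => by fun_prop
  have hstart : maxAbs 0 ≤ 1 := Finset.sup'_le _ _ fun i hi => by simpa using hx i hi
  have hend : 1 ≤ maxAbs (2 / |u p|) := by
    refine le_trans ?_ (Finset.le_sup' (fun i => |x i + 2 / |u p| * u i|) hp)
    have hstep : |2 / |u p| * u p| = 2 := by
      rw [abs_mul, abs_div, abs_abs, abs_two, div_mul_cancel₀ _ (abs_ne_zero.2 hu)]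
    have := abs_sub_abs_le_abs_sub (2 / |u p| * u p) (-x p)
    rw [hstep, abs_neg, sub_neg_eq_add, add_comm] at this
    linarith [hx p hp]
  obtain ⟨δ, hδ, hone⟩ := intermediate_value_Icc (by positivity) hcont.continuousOn ⟨hstart, hend⟩
  refine ⟨δ, hδ.1, fun i hi => ?_, ?_⟩
  · exact hone ▸ Finset.le_sup' (fun i => |x i + δ * u i|) hi
  · obtain ⟨i, hi, heq⟩ := Finset.exists_mem_eq_sup' ⟨p, hp⟩ fun i => |x i + δ * u i|
    exact ⟨i, hi, heq.symm.trans hone⟩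

variable {ι E : Type*} [Fintype ι] [NormedAddCommGroup E] [InnerProductSpace ℝ E]

instance finiteDimensional_span_image {ι : Type*} (v : ι → E) (B : Finset ι) :
    FiniteDimensional ℝ (Submodule.span ℝ (v '' B)) :=
  FiniteDimensional.span_of_finite ℝ (B.finite_toSet.image v)

/-- The potential of the Gram–Schmidt walk at the fractional signs `x`, when `p` is the pivot and
`B` is the set of the other active indices. It bounds the moment generating function, as a function
of `θ`, of the signed sum that the walk produces from `x`. -/
noncomputable def walkPotential (v : ι → E) (B : Finset ι) (p : ι) (x : ι → ℝ) (θ : E) : ℝ :=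
  Real.exp (inner ℝ θ (∑ i, x i • v i)) * walkFactor (Submodule.span ℝ (v '' B)) (v p) θ (x p)

theorem exists_walkPotential_add_smul_eq (v : ι → E) {B : Finset ι} {p : ι} {u : ι → ℝ}
    (hup : u p = 1)
    (hu : ∑ i, u i • v i = (Submodule.span ℝ (v '' B))ᗮ.starProjection (v p)) (x : ι → ℝ) :
    ∃ slope : E → ℝ, ∀ δ : ℝ,
      walkPotential v B p (x + δ • u) = walkPotential v B p x + δ • slope := by
  set W := Submodule.span ℝ (v '' B)
  set a : E → ℝ := fun θ => inner ℝ θ (Wᗮ.starProjection (v p)) with ha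
  refine ⟨fun θ => Real.exp (inner ℝ θ (∑ i, x i • v i)) *
    (Real.exp (‖(W ⊔ Submodule.span ℝ {v p}).starProjection θ‖ ^ 2 / 2) *
      (Real.exp (-(a θ ^ 2 / 2) - a θ * x p) * Real.sinh (a θ))), fun δ => funext fun θ => ?_⟩
  have hinner : inner ℝ θ (∑ i, (x + δ • u) i • v i) =
      inner ℝ θ (∑ i, x i • v i) + δ * a θ := by
    simp only [Pi.add_apply, Pi.smul_apply, smul_eq_mul, add_smul, mul_smul,
      Finset.sum_add_distrib, ← Finset.smul_sum, hu, inner_add_right, inner_smul_right, ha, W]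
  have hpivot : (x + δ • u) p = x p + δ := by simp [hup]
  simp only [walkPotential, walkFactor, Pi.add_apply, Pi.smul_apply, smul_eq_mul] at hpivot hinner ⊢
  rw [hinner, hpivot, Real.exp_add]
  linear_combination Real.exp (inner ℝ θ (∑ i, x i • v i)) *
    Real.exp (‖(W ⊔ Submodule.span ℝ {v p}).starProjection θ‖ ^ 2 / 2) *
      exp_mul_pivotFactor_add (a θ) (x p) δ

/-- The functions on `E` that dominate the moment generating function
`θ ↦ 𝔼 exp ⟪θ, ∑ i, y i • v i⟫` of some random signs `y` with `y = x` off `A`. The law of `y` is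
encoded by the weights of a convex combination. -/
def mgfMajorants (v : ι → E) (A : Finset ι) (x : ι → ℝ) : UpperSet (E → ℝ) :=
  upperClosure (convexHull ℝ
    ((fun (y : ι → ℝ) (θ : E) => Real.exp (inner ℝ θ (∑ i, y i • v i))) ''
      {y | (∀ i, |y i| = 1) ∧ ∀ i ∉ A, y i = x i}))

theorem convex_mgfMajorants (v : ι → E) (A : Finset ι) (x : ι → ℝ) :
    Convex ℝ (mgfMajorants v A x : Set (E → ℝ)) := by
  intro F hF G hG a b ha hb hab
  obtain ⟨f, hf, hfF⟩ := mem_upperClosure.1 hF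
  obtain ⟨g, hg, hgG⟩ := mem_upperClosure.1 hG
  exact mem_upperClosure.2 ⟨a • f + b • g, convex_convexHull ℝ _ hf hg ha hb hab,
    add_le_add (smul_le_smul_of_nonneg_left hfF ha) (smul_le_smul_of_nonneg_left hgG hb)⟩

theorem mgfMajorants_le_of_subset {v : ι → E} {A A' : Finset ι} {x x' : ι → ℝ} (hA : A' ⊆ A)
    (hx : ∀ i ∉ A, x' i = x i) : mgfMajorants v A x ≤ mgfMajorants v A' x' := by
  refine upperClosure_anti (convexHull_mono (Set.image_mono ?_))
  exact fun y ⟨hy, hoff⟩ => ⟨hy, fun i hi => (hoff i fun h => hi (hA h)).trans (hx i hi)⟩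

/-- The moment generating function, at `θ`, of a Gaussian vector with mean `∑ i, x i • v i` whose
covariance is the orthogonal projection onto the span of the vectors with index in `A`. -/
noncomputable def gaussianPotential (v : ι → E) (A : Finset ι) (x : ι → ℝ) (θ : E) : ℝ :=
  Real.exp (inner ℝ θ (∑ i, x i • v i)) *
    Real.exp (‖(Submodule.span ℝ (v '' A)).starProjection θ‖ ^ 2 / 2)

variable {v : ι → E} {x : ι → ℝ}

theorem gaussianPotential_mem_mgfMajorants_of_abs_eq_one (hx : ∀ i, |x i| = 1) (A : Finset ι) :
    gaussianPotential v A x ∈ mgfMajorants v A x :=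
  mem_upperClosure.2 ⟨_, subset_convexHull ℝ _ ⟨x, ⟨hx, fun _ _ => rfl⟩, rfl⟩, fun _ =>
    le_mul_of_one_le_right (Real.exp_pos _).le (Real.one_le_exp (by positivity))⟩

theorem gaussianPotential_le_walkPotential (B : Finset ι) {p : ι} (hv : ‖v p‖ ≤ 1)
    (hx : |x p| = 1) : gaussianPotential v B x ≤ walkPotential v B p x := fun θ =>
  mul_le_mul_of_nonneg_left (exp_le_walkFactor _ hv θ hx) (Real.exp_pos _).le

theorem walkPotential_mono {B B' : Finset ι} (hB : B' ⊆ B) {p : ι} (hv : ‖v p‖ ≤ 1)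
    (hx : |x p| ≤ 1) : walkPotential v B' p x ≤ walkPotential v B p x := fun θ =>
  mul_le_mul_of_nonneg_left (walkFactor_mono (Submodule.span_mono
    (Set.image_mono (Finset.coe_subset.2 hB))) hv θ hx) (Real.exp_pos _).le

variable [DecidableEq ι]

theorem walkPotential_le_gaussianPotential (B : Finset ι) {p : ι} (hx : |x p| ≤ 1) :
    walkPotential v B p x ≤ gaussianPotential v (insert p B) x := fun θ => by
  have hspan : Submodule.span ℝ (v '' B) ⊔ Submodule.span ℝ {v p} ≤
      Submodule.span ℝ (v '' ↑(insert p B)) := by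
    rw [Finset.coe_insert, Set.image_insert_eq, Submodule.span_insert, sup_comm]
  refine mul_le_mul_of_nonneg_left ((walkFactor_le _ _ _ hx).trans (Real.exp_le_exp.2 ?_))
    (Real.exp_pos _).le
  exact div_le_div_of_nonneg_right (norm_sq_starProjection_le_of_le hspan θ) zero_le_two

theorem exists_walk_direction (v : ι → E) {B : Finset ι} {p : ι} (hp : p ∉ B) :
    ∃ u : ι → ℝ, u p = 1 ∧ (∀ i ∉ insert p B, u i = 0) ∧
      ∑ i, u i • v i = (Submodule.span ℝ (v '' B))ᗮ.starProjection (v p) := by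
  obtain ⟨w, hw⟩ := (Submodule.mem_span_image_finset_iff_exists_fun' ℝ).1
    (Submodule.starProjection_apply_mem (Submodule.span ℝ (v '' B)) (v p))
  refine ⟨fun i => if i = p then 1 else if i ∈ B then -w i else 0, if_pos rfl, fun i hi => ?_, ?_⟩
  · rw [Finset.mem_insert, not_or] at hi
    simp [hi.1, hi.2]
  have hsplit : ∀ i, (if i = p then 1 else if i ∈ B then -w i else 0) • v i =
      (if i = p then v i else 0) - if i ∈ B then w i • v i else 0 := fun i => by
    by_cases hip : i = p
    · simp [hip, hp]
    · by_cases hiB : i ∈ B <;> simp [hip, hiB]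
  rw [Finset.sum_congr rfl fun i _ => hsplit i, Finset.sum_sub_distrib, Finset.sum_ite_eq',
    if_pos (Finset.mem_univ p), Finset.sum_ite_mem, Finset.univ_inter, hw,
    Submodule.starProjection_orthogonal_val]

theorem exists_mem_segment_walkPotential (v : ι → E) {B : Finset ι} {p : ι} (hp : p ∉ B)
    {x : ι → ℝ} (hx : ∀ i, |x i| ≤ 1) :
    ∃ x₀ x₁ : ι → ℝ, walkPotential v B p x ∈
        segment ℝ (walkPotential v B p x₀) (walkPotential v B p x₁) ∧
      ∀ x' ∈ ({x₀, x₁} : Set (ι → ℝ)), (∀ i, |x' i| ≤ 1) ∧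
        (∀ i ∉ insert p B, x' i = x i) ∧ ∃ i ∈ insert p B, |x' i| = 1 := by
  obtain ⟨u, hup, huoff, hu⟩ := exists_walk_direction v hp
  obtain ⟨slope, hslope⟩ := exists_walkPotential_add_smul_eq v hup hu x
  have hpB := Finset.mem_insert_self p B
  obtain ⟨δ₀, hδ₀, hle₀, hhit₀⟩ := exists_boundary_step hpB (u := -u) (fun i _ => hx i)
    (by simp [hup])
  obtain ⟨δ₁, hδ₁, hle₁, hhit₁⟩ := exists_boundary_step hpB (u := u) (fun i _ => hx i)
    (by simp [hup])
  have hstep : ∀ δ : ℝ, (∀ i ∈ insert p B, |x i + δ * u i| ≤ 1) →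
      (∃ i ∈ insert p B, |x i + δ * u i| = 1) → (∀ i, |(x + δ • u) i| ≤ 1) ∧
        (∀ i ∉ insert p B, (x + δ • u) i = x i) ∧ ∃ i ∈ insert p B, |(x + δ • u) i| = 1 := by
    intro δ hle hhit
    have hoff : ∀ i ∉ insert p B, (x + δ • u) i = x i := fun i hi => by simp [huoff i hi]
    refine ⟨fun i => ?_, hoff, hhit⟩
    by_cases hi : i ∈ insert p B
    · exact hle i hi
    · exact (hoff i hi).symm ▸ hx i
  refine ⟨x + (-δ₀) • u, x + δ₁ • u, ?_, ?_⟩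
  · obtain ⟨a, b, ha, hb, hab, hzero⟩ : (0 : ℝ) ∈ segment ℝ (-δ₀) δ₁ := by
      rw [segment_eq_Icc (by linarith)]
      exact ⟨by linarith, hδ₁⟩
    refine ⟨a, b, ha, hb, hab, funext fun θ => ?_⟩
    simp only [hslope, Pi.add_apply, Pi.smul_apply, smul_eq_mul] at hzero ⊢
    linear_combination walkPotential v B p x θ * hab + slope θ * hzero
  · rintro x' (rfl | rfl)
    · exact hstep (-δ₀) (by simpa using hle₀) (by simpa using hhit₀)
    · exact hstep δ₁ hle₁ hhit₁

theorem potentials_mem_mgfMajorants (hv : ∀ i, ‖v i‖ ≤ 1) (A : Finset ι) :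
    ∀ x : ι → ℝ, (∀ i, |x i| ≤ 1) → (∀ i ∉ A, |x i| = 1) →
      gaussianPotential v A x ∈ mgfMajorants v A x ∧
        ∀ p ∈ A, walkPotential v (A.erase p) p x ∈ mgfMajorants v A x := by
  induction A using Finset.strongInduction with
  | H A ih =>
  intro x hx hxA
  have hwalk : ∀ p ∈ A, walkPotential v (A.erase p) p x ∈ mgfMajorants v A x := by
    intro p hp
    obtain ⟨x₀, x₁, hseg, hend⟩ := exists_mem_segment_walkPotential v (A.notMem_erase p) hx
    rw [Finset.insert_erase hp] at hend
    have hmem : ∀ x' ∈ ({x₀, x₁} : Set (ι → ℝ)),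
        walkPotential v (A.erase p) p x' ∈ mgfMajorants v A x := by
      intro x' hx'
      obtain ⟨hle, hoff, i, hi, hhit⟩ := hend x' hx'
      have hoffi : ∀ j ∉ A.erase i, |x' j| = 1 := fun j hj => by
        rcases eq_or_ne j i with rfl | hji
        · exact hhit
        · have hjA : j ∉ A := fun h => hj (Finset.mem_erase.2 ⟨hji, h⟩)
          rw [hoff j hjA, hxA j hjA]
      obtain ⟨hgauss, hpivot⟩ := ih (A.erase i) (Finset.erase_ssubset hi) x' hle hoffi
      refine mgfMajorants_le_of_subset (A.erase_subset i) hoff ?_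
      rcases eq_or_ne p i with rfl | hpi
      · exact (mgfMajorants v _ x').upper (gaussianPotential_le_walkPotential _ (hv p) hhit) hgauss
      · refine (mgfMajorants v _ x').upper (walkPotential_mono ?_ (hv p) (hle p))
          (hpivot p (Finset.mem_erase.2 ⟨hpi, hp⟩))
        exact Finset.erase_subset_erase p (A.erase_subset i)
    exact (convex_mgfMajorants v A x).segment_subset (hmem x₀ (by simp)) (hmem x₁ (by simp)) hseg
  refine ⟨?_, hwalk⟩
  rcases A.eq_empty_or_nonempty with rfl | ⟨p, hp⟩
  · exact gaussianPotential_mem_mgfMajorants_of_abs_eq_one (fun i => hxA i (by simp)) ∅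
  · have hle := walkPotential_le_gaussianPotential (v := v) (A.erase p) (hx p)
    rw [Finset.insert_erase hp] at hle
    exact (mgfMajorants v A x).upper hle (hwalk p hp)

end GramSchmidtWalk

section SignBalancing

variable {ι κ E : Type*} [Fintype ι] [Fintype κ] [NormedAddCommGroup E] [InnerProductSpace ℝ E]
  {v : ι → E} {x : ι → ℝ}

theorem exists_signs_sum_exp_le (hv : ∀ i, ‖v i‖ ≤ 1) (θ : κ → E)
    (hx : ∀ i, |x i| ≤ 1) :
    ∃ y : ι → ℝ, (∀ i, |y i| = 1) ∧ (∀ i, |x i| = 1 → y i = x i) ∧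
      ∑ a, Real.exp (inner ℝ (θ a) (∑ i, (y i - x i) • v i)) ≤ ∑ a, Real.exp (‖θ a‖ ^ 2 / 2) := by
  classical
  have hmem := (potentials_mem_mgfMajorants hv {i | |x i| ≠ 1} x hx (by simp)).1
  obtain ⟨f, hf, hfle⟩ := mem_upperClosure.1 hmem
  let Λ : (E → ℝ) →ₗ[ℝ] ℝ :=
    ∑ a, Real.exp (-inner ℝ (θ a) (∑ i, x i • v i)) • LinearMap.proj (θ a)
  have hΛ : ∀ F : E → ℝ, Λ F = ∑ a, Real.exp (-inner ℝ (θ a) (∑ i, x i • v i)) * F (θ a) :=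
    fun F => by simp [Λ]
  obtain ⟨_, ⟨y, ⟨hy, hoff⟩, rfl⟩, hle⟩ := ConcaveOn.exists_le_of_mem_convexHull
    (Λ.concaveOn convex_univ) (Set.subset_univ _) hf
  refine ⟨y, hy, fun i hi => hoff i (by simp [hi]), ?_⟩
  calc ∑ a, Real.exp (inner ℝ (θ a) (∑ i, (y i - x i) • v i))
      = Λ fun θ => Real.exp (inner ℝ θ (∑ i, y i • v i)) := by
        rw [hΛ]
        refine Finset.sum_congr rfl fun a _ => ?_
        rw [← Real.exp_add, neg_add_eq_sub, ← inner_sub_right, ← Finset.sum_sub_distrib]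
        simp only [sub_smul]
    _ ≤ Λ f := hle
    _ ≤ ∑ a, Real.exp (‖θ a‖ ^ 2 / 2) := by
        rw [hΛ]
        refine Finset.sum_le_sum fun a _ => ?_
        refine (mul_le_mul_of_nonneg_left (hfle (θ a)) (Real.exp_pos _).le).trans ?_
        rw [gaussianPotential, ← mul_assoc, ← Real.exp_add, neg_add_cancel, Real.exp_zero, one_mul]
        gcongr
        exact Submodule.norm_starProjection_apply_le _ _

theorem exists_signs_inner_le (hκ : 1 < Fintype.card κ)
    (hv : ∀ i, ‖v i‖ ≤ 1) {θ : κ → E} (hθ : ∀ a, ‖θ a‖ ≤ 1) (hx : ∀ i, |x i| ≤ 1) :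
    ∃ y : ι → ℝ, (∀ i, |y i| = 1) ∧ (∀ i, |x i| = 1 → y i = x i) ∧
      ∀ a, inner ℝ (θ a) (∑ i, (y i - x i) • v i) ≤ √(2 * Real.log (Fintype.card κ)) := by
  set r := √(2 * Real.log (Fintype.card κ))
  have hlog : 0 < Real.log (Fintype.card κ) := Real.log_pos (by exact_mod_cast hκ)
  have hr : 0 < r := Real.sqrt_pos.2 (by positivity)
  have hrsq : r ^ 2 = 2 * Real.log (Fintype.card κ) := Real.sq_sqrt (by positivity)
  obtain ⟨y, hy, hyx, hsum⟩ := exists_signs_sum_exp_le hv (fun a => r • θ a) hx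
  refine ⟨y, hy, hyx, fun a => ?_⟩
  have hnorm : ∀ b, ‖r • θ b‖ ≤ r := fun b => by
    rw [norm_smul, Real.norm_of_nonneg hr.le]
    exact mul_le_of_le_one_right hr.le (hθ b)
  have hexp : Real.exp (r * inner ℝ (θ a) (∑ i, (y i - x i) • v i)) ≤ Real.exp (r * r) :=
    calc Real.exp (r * inner ℝ (θ a) (∑ i, (y i - x i) • v i))
        = Real.exp (inner ℝ (r • θ a) (∑ i, (y i - x i) • v i)) := by rw [real_inner_smul_left]
      _ ≤ ∑ b, Real.exp (inner ℝ (r • θ b) (∑ i, (y i - x i) • v i)) :=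
        Finset.single_le_sum
          (f := fun b => Real.exp (inner ℝ (r • θ b) (∑ i, (y i - x i) • v i)))
          (fun b _ => (Real.exp_pos _).le) (Finset.mem_univ a)
      _ ≤ ∑ b, Real.exp (‖r • θ b‖ ^ 2 / 2) := hsum
      _ ≤ ∑ _b : κ, Real.exp (r ^ 2 / 2) := by
        gcongr with b
        exact hnorm b
      _ = Real.exp (r * r) := by
        rw [Finset.sum_const, nsmul_eq_mul, Finset.card_univ,
          ← Real.exp_log (Nat.cast_pos.2 (zero_lt_one.trans hκ)), ← Real.exp_add]
        congr 1
        linarith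
  exact le_of_mul_le_mul_left (Real.exp_le_exp.1 hexp) hr

theorem exists_signs_abs_inner_le [Nonempty κ] {ρ σ : ℝ} (hρ : 0 < ρ)
    (hσ : 0 < σ) (hv : ∀ i, ‖v i‖ ≤ ρ) {θ : κ → E} (hθ : ∀ a, ‖θ a‖ ≤ σ) (hx : ∀ i, |x i| ≤ 1) :
    ∃ y : ι → ℝ, (∀ i, |y i| = 1) ∧ (∀ i, |x i| = 1 → y i = x i) ∧
      ∀ a, |inner ℝ (θ a) (∑ i, (y i - x i) • v i)| ≤
        ρ * σ * √(2 * Real.log (2 * Fintype.card κ)) := by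
  have hunit : ∀ {τ : ℝ} {z : E}, 0 < τ → ‖z‖ ≤ τ → ‖τ⁻¹ • z‖ ≤ 1 := fun hτ hz => by
    rwa [norm_smul, norm_inv, Real.norm_of_nonneg hτ.le, inv_mul_le_one₀ hτ]
  have hcard : Fintype.card (κ ⊕ κ) = 2 * Fintype.card κ := by rw [Fintype.card_sum, two_mul]
  have hκ : 1 < Fintype.card (κ ⊕ κ) := by
    have := Fintype.card_pos (α := κ)
    omega
  obtain ⟨y, hy, hyx, hle⟩ := exists_signs_inner_le (v := fun i => ρ⁻¹ • v i)
    (θ := Sum.elim (fun a => σ⁻¹ • θ a) fun a => -(σ⁻¹ • θ a)) hκ (fun i => hunit hρ (hv i))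
    (by rintro (a | a) <;> simpa using hunit hσ (hθ a)) hx
  refine ⟨y, hy, hyx, fun a => ?_⟩
  have hscale : inner ℝ (σ⁻¹ • θ a) (∑ i, (y i - x i) • ρ⁻¹ • v i) =
      (ρ * σ)⁻¹ * inner ℝ (θ a) (∑ i, (y i - x i) • v i) := by
    simp only [smul_comm _ ρ⁻¹, ← Finset.smul_sum]
    rw [real_inner_smul_left, real_inner_smul_right, mul_inv]
    ring
  have hpos := hle (Sum.inl a)
  have hneg := hle (Sum.inr a)
  simp only [Sum.elim_inl, Sum.elim_inr, inner_neg_left, hscale, hcard, Nat.cast_mul,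
    Nat.cast_two] at hpos hneg
  rw [mul_comm (ρ * σ), ← div_le_iff₀ (mul_pos hρ hσ), div_eq_inv_mul,
    ← abs_of_pos (inv_pos.2 (mul_pos hρ hσ)), ← abs_mul]
  exact abs_le'.2 ⟨hpos, hneg⟩

end SignBalancing

section DyadicFactorization

theorem sum_range_first_differing_digit (k : ℕ) : ∀ i a : ℕ, i < 2 ^ k → a < 2 ^ k →
    ∑ l ∈ Finset.range k, (if (i / 2 ^ l % 2 = 0 ∧ i / 2 ^ (l + 1) = a / 2 ^ (l + 1)) ∧
      a / 2 ^ l % 2 = 1 then (1 : ℝ) else 0) = if i < a then 1 else 0 := by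
  induction k with
  | zero =>
    intro i a hi ha
    simp only [pow_zero, Nat.lt_one_iff] at hi ha
    simp [hi, ha]
  | succ k ih =>
    intro i a hi ha
    rw [pow_succ] at hi ha
    have hhigh := ih (i / 2) (a / 2) (by omega) (by omega)
    simp only [Nat.div_div_eq_div_mul, ← pow_succ'] at hhigh
    rw [Finset.sum_range_succ', hhigh]
    simp only [pow_zero, Nat.div_one, zero_add, pow_one]
    split_ifs <;> first | omega | norm_num

/-- The indicator vector of the pairs `(l, b)` such that the digit of `i` at level `l` is `e` and
the digits of `i` above level `l` form the number `b`. For `e = 0` these are the left halves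
`[2 ^ (l + 1) * b, 2 ^ (l + 1) * b + 2 ^ l)` of dyadic intervals that contain `i`, for `e = 1` they
are those whose disjoint union is `[0, i)`. -/
noncomputable def dyadicVec (k e i : ℕ) : EuclideanSpace ℝ (Fin k × Fin (2 ^ k)) :=
  WithLp.toLp 2 fun q => if i / 2 ^ q.1.1 % 2 = e ∧ i / 2 ^ (q.1.1 + 1) = q.2.1 then 1 else 0

theorem norm_dyadicVec_le (k e i : ℕ) : ‖dyadicVec k e i‖ ≤ √k := by
  rw [EuclideanSpace.norm_eq]
  refine Real.sqrt_le_sqrt ?_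
  have hrow : ∀ l : Fin k, ∑ b, ‖dyadicVec k e i (l, b)‖ ^ 2 ≤ 1 := fun l => by
    have hsq : ∀ b, ‖dyadicVec k e i (l, b)‖ ^ 2 =
        if i / 2 ^ l.1 % 2 = e ∧ i / 2 ^ (l.1 + 1) = b.1 then 1 else 0 := fun b => by
      rw [dyadicVec, PiLp.toLp_apply]
      split_ifs <;> norm_num
    simp only [hsq, Finset.sum_boole]
    refine Nat.cast_le_one.2 (Finset.card_le_one.2 fun b hb c hc => Fin.ext ?_)
    rw [Finset.mem_filter] at hb hc
    exact hb.2.2.symm.trans hc.2.2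
  rw [Fintype.sum_prod_type]
  exact (Finset.sum_le_card_nsmul _ _ _ fun l _ => hrow l).trans_eq (by simp)

theorem inner_dyadicVec {k i a : ℕ} (hi : i < 2 ^ k) (ha : a < 2 ^ k) :
    inner ℝ (dyadicVec k 1 a) (dyadicVec k 0 i) = if i < a then 1 else 0 := by
  rw [← sum_range_first_differing_digit k i a hi ha, PiLp.inner_apply, Fintype.sum_prod_type,
    Finset.sum_range]
  refine Finset.sum_congr rfl fun l _ => ?_
  have hlt : i / 2 ^ (l.1 + 1) < 2 ^ k := (Nat.div_le_self _ _).trans_lt hi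
  rw [Finset.sum_eq_single_of_mem (⟨_, hlt⟩ : Fin (2 ^ k)) (Finset.mem_univ _)]
  · rw [RCLike.inner_apply, conj_trivial, dyadicVec, dyadicVec, PiLp.toLp_apply, PiLp.toLp_apply,
      ite_zero_mul_ite_zero, one_mul]
    refine if_congr ?_ rfl rfl
    grind
  · intro b _ hb
    have : ¬ (i / 2 ^ (l.1 + 1) = b.1) := fun h => hb (Fin.ext h.symm)
    simp [dyadicVec, this]

variable {ι κ : Type*} [Fintype ι]

/-- The pure tensor `⨂ j, f j`, in coordinates. -/
noncomputable def tensorVec (f : ι → EuclideanSpace ℝ κ) : EuclideanSpace ℝ (ι → κ) :=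
  WithLp.toLp 2 fun q => ∏ j, f j (q j)

variable [DecidableEq ι] [Fintype κ]

theorem inner_tensorVec (f g : ι → EuclideanSpace ℝ κ) :
    inner ℝ (tensorVec f) (tensorVec g) = ∏ j, inner ℝ (f j) (g j) := by
  simp only [PiLp.inner_apply, tensorVec, Finset.prod_univ_sum, Fintype.piFinset_univ,
    RCLike.inner_apply, conj_trivial, Finset.prod_mul_distrib]

theorem norm_tensorVec (f : ι → EuclideanSpace ℝ κ) : ‖tensorVec f‖ = ∏ j, ‖f j‖ := by
  refine (sq_eq_sq₀ (norm_nonneg _) (Finset.prod_nonneg fun j _ => norm_nonneg (f j))).1 ?_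
  simp only [← real_inner_self_eq_norm_sq, inner_tensorVec, ← Finset.prod_pow]

theorem norm_tensorVec_dyadicVec_le (k e : ℕ) (c : ι → ℕ) :
    ‖tensorVec fun j => dyadicVec k e (c j)‖ ≤ √k ^ Fintype.card ι := by
  rw [norm_tensorVec]
  exact (Finset.prod_le_prod (fun j _ => norm_nonneg _)
    fun j _ => norm_dyadicVec_le k e (c j)).trans_eq (by simp)

theorem inner_tensorVec_dyadicVec {k : ℕ} {a c : ι → ℕ} (ha : ∀ j, a j < 2 ^ k)
    (hc : ∀ j, c j < 2 ^ k) :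
    inner ℝ (tensorVec fun j => dyadicVec k 1 (a j)) (tensorVec fun j => dyadicVec k 0 (c j)) =
      if ∀ j, c j < a j then (1 : ℝ) else 0 := by
  simp only [inner_tensorVec, inner_dyadicVec (hc _) (ha _), Finset.prod_ite_zero,
    Finset.prod_const_one, Finset.mem_univ, true_imp_iff]

end DyadicFactorization

section GridRounding

variable {ι : Type*} [Fintype ι] [DecidableEq ι] [Nonempty ι] {k m : ℕ}

theorem sqrt_two_mul_log_two_mul_pow_le {N : ℕ} (hN : N ≠ 0) :
    √(2 * Real.log (2 * 2 ^ N)) ≤ 2 * √N := by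
  have hN1 : (1 : ℝ) ≤ N := Nat.one_le_cast.2 (Nat.one_le_iff_ne_zero.2 hN)
  have hlog2 : Real.log 2 ≤ 1 := Real.log_two_lt_d9.le.trans (by norm_num)
  refine Real.sqrt_le_iff.2 ⟨by positivity, ?_⟩
  rw [← pow_succ', Real.log_pow, mul_pow, Real.sq_sqrt N.cast_nonneg]
  push_cast
  nlinarith

theorem exists_signs_abs_sum_box_le (hk : k ≠ 0) (hm : m < 2 ^ k) {x : (ι → Fin m) → ℝ}
    (hx : ∀ c, |x c| ≤ 1) :
    ∃ y : (ι → Fin m) → ℝ, (∀ c, |y c| = 1) ∧ (∀ c, |x c| = 1 → y c = x c) ∧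
      ∀ a : ι → ℕ, |∑ c with ∀ j, (c j : ℕ) < a j, (y c - x c)| ≤
        2 * √(k * Fintype.card ι : ℕ) * k ^ Fintype.card ι := by
  have hρ : 0 < √(k : ℝ) ^ Fintype.card ι := by
    have : 0 < k := Nat.pos_of_ne_zero hk
    positivity
  obtain ⟨y, hy, hyx, hle⟩ := exists_signs_abs_inner_le (κ := ι → Fin (2 ^ k)) hρ hρ
    (v := fun c => tensorVec fun j => dyadicVec k 0 (c j))
    (θ := fun a => tensorVec fun j => dyadicVec k 1 (a j))
    (fun c => norm_tensorVec_dyadicVec_le k 0 _) (fun a => norm_tensorVec_dyadicVec_le k 1 _) hx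
  refine ⟨y, hy, hyx, fun a => ?_⟩
  have hcap : ∀ j, min (a j) m < 2 ^ k := fun j => (min_le_right _ _).trans_lt hm
  have hsum : inner ℝ (tensorVec fun j => dyadicVec k 1 (min (a j) m))
      (∑ c, (y c - x c) • tensorVec fun j => dyadicVec k 0 (c j : ℕ)) =
      ∑ c with ∀ j, (c j : ℕ) < a j, (y c - x c) := by
    rw [inner_sum, Finset.sum_filter]
    refine Finset.sum_congr rfl fun c _ => ?_
    rw [real_inner_smul_right, inner_tensorVec_dyadicVec hcap fun j => (c j).2.trans hm, mul_ite,
      mul_one, mul_zero]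
    simp only [lt_min_iff, Fin.is_lt, and_true]
  have hcard : (Fintype.card (ι → Fin (2 ^ k)) : ℝ) = 2 ^ (k * Fintype.card ι) := by
    simp [pow_mul]
  rw [← hsum]
  refine (hle fun j => ⟨_, hcap j⟩).trans ?_
  rw [hcard, ← mul_pow, Real.mul_self_sqrt k.cast_nonneg, mul_comm]
  gcongr
  exact sqrt_two_mul_log_two_mul_pow_le (mul_ne_zero hk Fintype.card_ne_zero)

theorem exists_nat_abs_sum_box_sub_le (hk : k ≠ 0) (hm : m < 2 ^ k) {w : (ι → Fin m) → ℝ}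
    (hw : ∀ c, 0 ≤ w c) :
    ∃ N : (ι → Fin m) → ℕ, (∀ c, w c = 0 → N c = 0) ∧
      ∀ a : ι → ℕ, |∑ c with ∀ j, (c j : ℕ) < a j, ((N c : ℝ) - w c)| ≤
        √(k * Fintype.card ι : ℕ) * k ^ Fintype.card ι := by
  obtain ⟨y, hy, hyx, hle⟩ := exists_signs_abs_sum_box_le (x := fun c => 2 * Int.fract (w c) - 1)
    hk hm fun c => abs_le.2 (by
      constructor <;> linarith [Int.fract_nonneg (w c), Int.fract_lt_one (w c)])
  refine ⟨fun c => ⌊w c⌋₊ + if y c = 1 then 1 else 0, fun c hc => ?_, fun a => ?_⟩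
  · have hyc : y c = -1 := by simpa [hc] using hyx c (by simp [hc])
    norm_num [hyc, hc]
  have hround : ∀ c, ((⌊w c⌋₊ + if y c = 1 then 1 else 0 : ℕ) : ℝ) - w c =
      (y c - (2 * Int.fract (w c) - 1)) / 2 := fun c => by
    have hfloor : (⌊w c⌋₊ : ℝ) = w c - Int.fract (w c) := by
      rw [natCast_floor_eq_intCast_floor (hw c), Int.self_sub_fract]
    rw [Nat.cast_add, hfloor]
    rcases eq_or_eq_neg_of_abs_eq (hy c) with h | h
    · rw [if_pos h, h]; push_cast; ring
    · rw [if_neg (by rw [h]; norm_num), h]; push_cast; ring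
  simp only [hround]
  rw [← Finset.sum_div, abs_div, abs_two, div_le_iff₀ two_pos]
  linarith [hle a]

end GridRounding

section Points

theorem abs_count_sub_count_le (p : ℕ → Prop) [DecidablePred p] (a b : ℕ) :
    |(Nat.count p a : ℝ) - Nat.count p b| ≤ |(a : ℝ) - b| := by
  wlog h : b ≤ a generalizing a b
  · rw [abs_sub_comm, abs_sub_comm (a : ℝ)]
    exact this b a (le_of_not_ge h)
  obtain ⟨l, rfl⟩ := Nat.exists_eq_add_of_le h
  rw [Nat.count_add]
  push_cast
  rw [add_sub_cancel_left, add_sub_cancel_left, Nat.abs_cast, Nat.abs_cast]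
  exact Nat.cast_le.2 (Nat.count_le _)

theorem card_filter_fin_eq_count (p : ℕ → Prop) [DecidablePred p] (n : ℕ) :
    Finset.card {i : Fin n | p i} = Nat.count p n := by
  rw [Nat.count_eq_card_filter_range, Finset.card_filter, Finset.card_filter,
    Fin.sum_univ_eq_sum_range (fun i => if p i then 1 else 0)]

theorem exists_seq_count_eq_sum {Ω κ : Type*} [Nonempty Ω] [Fintype κ] (N : κ → ℕ)
    (pt : κ → Ω) : ∃ F : ℕ → Ω, ∀ P : Ω → Prop, ∀ [DecidablePred P],
      Nat.count (fun i => P (F i)) (∑ c, N c) = ∑ c with P (pt c), N c := by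
  obtain ⟨ω₀⟩ := ‹Nonempty Ω›
  let e : Fin (∑ c, N c) ≃ Σ c, Fin (N c) := (Fintype.equivFinOfCardEq (by simp)).symm
  refine ⟨fun i => if h : i < ∑ c, N c then pt (e ⟨i, h⟩).1 else ω₀, fun P _ => ?_⟩
  rw [← card_filter_fin_eq_count, Finset.card_filter, Finset.sum_filter]
  simp only [Fin.is_lt, dite_true]
  rw [e.sum_comp fun x => if P (pt x.1) then 1 else 0, Fintype.sum_sigma]
  exact Finset.sum_congr rfl fun c _ => by split_ifs <;> simp

theorem exists_points_abs_card_sub_sum_le {Ω κ : Type*} [Nonempty Ω] [Fintype κ] (N : κ → ℕ)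
    (pt : κ → Ω) (n : ℕ) : ∃ f : Fin n → Ω, ∀ P : Ω → Prop, ∀ [DecidablePred P],
      |(Finset.card {i | P (f i)} : ℝ) - ∑ c with P (pt c), (N c : ℝ)| ≤ |∑ c, (N c : ℝ) - n| := by
  obtain ⟨F, hF⟩ := exists_seq_count_eq_sum N pt
  refine ⟨fun i => F i, fun P _ => ?_⟩
  have h := abs_count_sub_count_le (fun i => P (F i)) n (∑ c, N c)
  rw [hF, ← card_filter_fin_eq_count, abs_sub_comm (n : ℝ)] at h
  exact_mod_cast h

variable {Ω ι : Type*} [MeasurableSpace Ω] [Fintype ι] [Nonempty ι] {k m : ℕ}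

theorem exists_points_abs_card_cell_sub_measureReal_le (π : Measure Ω) [IsProbabilityMeasure π]
    (hk : k ≠ 0) (hm : m < 2 ^ k) {cell : Ω → ι → Fin m} (hcell : Measurable cell) (n : ℕ) :
    ∃ f : Fin n → Ω, ∀ a : ι → ℕ,
      |(Finset.card {i | ∀ j, (cell (f i) j : ℕ) < a j} : ℝ) -
        n * π.real {ω | ∀ j, (cell ω j : ℕ) < a j}| ≤
        2 * √(k * Fintype.card ι : ℕ) * k ^ Fintype.card ι := by
  classical
  have : Nonempty Ω := nonempty_of_isProbabilityMeasure π
  obtain ⟨N, hN0, hN⟩ := exists_nat_abs_sum_box_sub_le hk hm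
    (w := fun c => n * π.real (cell ⁻¹' {c})) fun c => by positivity
  have hmass (T : Finset (ι → Fin m)) :
      ∑ c ∈ T, n * π.real (cell ⁻¹' {c}) = n * π.real (cell ⁻¹' T) := by
    rw [← Finset.mul_sum,
      sum_measureReal_preimage_singleton _ fun c _ => hcell (measurableSet_singleton c)]
  have hoccupied (c) (hc : N c ≠ 0) : ∃ ω, cell ω = c := by
    by_contra! h
    exact hc (hN0 c (by simp [Set.preimage_singleton_eq_empty.2 (by simpa using h)]))
  choose! pt hpt using hoccupied
  obtain ⟨f, hf⟩ := exists_points_abs_card_sub_sum_le N pt n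
  refine ⟨f, fun a => ?_⟩
  have htotal : |∑ c, (N c : ℝ) - n| ≤ √(k * Fintype.card ι : ℕ) * k ^ Fintype.card ι := by
    simpa [Finset.sum_sub_distrib, hmass] using hN fun _ => m
  have hcount := hf fun ω => ∀ j, (cell ω j : ℕ) < a j
  have hpoints : ∑ c with ∀ j, (cell (pt c) j : ℕ) < a j, (N c : ℝ) =
      ∑ c with ∀ j, (c j : ℕ) < a j, (N c : ℝ) := by
    simp only [Finset.sum_filter]
    refine Finset.sum_congr rfl fun c _ => ?_
    rcases eq_or_ne (N c) 0 with hc | hc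
    · simp [hc]
    · rw [hpt c hc]
  have hround := hN a
  rw [Finset.sum_sub_distrib, hmass, ← hpoints] at hround
  simp only [Finset.coe_filter_univ, Set.preimage_ofPred_eq] at hround
  linarith [abs_sub_le _ _ _ |>.trans (add_le_add hcount hround)]

end Points

section QuantileCells

theorem measureReal_le_of_forall_measureReal_Icc_le {α : Type*} [LinearOrder α]
    [TopologicalSpace α] [OrderClosedTopology α] [MeasurableSpace α] {μ : Measure α}
    [IsFiniteMeasure μ] [μ.InnerRegularCompactLTTop] {S : Set α} (hS : MeasurableSet S)
    (hne : S.Nontrivial) {r : ℝ} (h : ∀ a ∈ S, ∀ b ∈ S, a < b → μ.real (Set.Icc a b) ≤ r) :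
    μ.real S ≤ r := by
  obtain ⟨z, hz, y, hy, hzy⟩ := hne.exists_lt
  have hr : 0 ≤ r := measureReal_nonneg.trans (h z hz y hy hzy)
  refine ENNReal.toReal_le_of_le_ofReal hr (le_of_not_gt fun hlt => ?_)
  obtain ⟨C, hCS, hC, hCr⟩ := hS.exists_lt_isCompact_of_ne_top (measure_ne_top _ _) hlt
  have hC' : IsCompact (insert z (insert y C)) := (hC.insert y).insert z
  obtain ⟨a, ha, hale⟩ := hC'.exists_isLeast (Set.insert_nonempty _ _)
  obtain ⟨b, hb, hleb⟩ := hC'.exists_isGreatest (Set.insert_nonempty _ _)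
  have hsub : insert z (insert y C) ⊆ S := Set.insert_subset hz (Set.insert_subset hy hCS)
  have hab : a < b := (hale (by simp)).trans_lt (hzy.trans_le (hleb (by simp)))
  have hCIcc : C ⊆ Set.Icc a b := fun t ht => ⟨hale (by simp [ht]), hleb (by simp [ht])⟩
  refine hCr.not_ge ((measure_mono hCIcc).trans ?_)
  rw [← ofReal_measureReal]
  exact ENNReal.ofReal_le_ofReal (h a (hsub ha) b (hsub hb) hab)

/-- The index of the cell of `x` in a partition of the line into consecutive intervals, each of
which is a single point or has mass at most `1 / n`. With `F` the distribution function of `μ`,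
it is `⌊n F(x-)⌋ + ⌈n F(x)⌉`. -/
noncomputable def quantileCell (μ : Measure ℝ) (n : ℕ) (x : ℝ) : ℕ :=
  ⌊n * μ.real (Set.Iio x)⌋₊ + ⌈n * μ.real (Set.Iic x)⌉₊

theorem monotone_floor_mul_measureReal_Iio (μ : Measure ℝ) [IsFiniteMeasure μ] (n : ℕ) :
    Monotone fun x => ⌊n * μ.real (Set.Iio x)⌋₊ := fun _ _ h =>
  Nat.floor_mono
    (mul_le_mul_of_nonneg_left (measureReal_mono (Set.Iio_subset_Iio h)) n.cast_nonneg)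

theorem monotone_ceil_mul_measureReal_Iic (μ : Measure ℝ) [IsFiniteMeasure μ] (n : ℕ) :
    Monotone fun x => ⌈n * μ.real (Set.Iic x)⌉₊ := fun _ _ h =>
  Nat.ceil_mono
    (mul_le_mul_of_nonneg_left (measureReal_mono (Set.Iic_subset_Iic.2 h)) n.cast_nonneg)

theorem monotone_quantileCell (μ : Measure ℝ) [IsFiniteMeasure μ] (n : ℕ) :
    Monotone (quantileCell μ n) :=
  (monotone_floor_mul_measureReal_Iio μ n).add (monotone_ceil_mul_measureReal_Iic μ n)

theorem quantileCell_le (μ : Measure ℝ) [IsProbabilityMeasure μ] (n : ℕ) (x : ℝ) :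
    quantileCell μ n x ≤ 2 * n := by
  have h (s : Set ℝ) : n * μ.real s ≤ n := mul_le_of_le_one_right n.cast_nonneg measureReal_le_one
  rw [two_mul]
  exact add_le_add (Nat.floor_le_of_le (h _)) (Nat.ceil_le.2 (h _))

theorem mul_measureReal_Icc_le_one_of_quantileCell_eq {μ : Measure ℝ} [IsFiniteMeasure μ] {n : ℕ}
    {a b : ℝ} (hab : a < b) (h : quantileCell μ n a = quantileCell μ n b) :
    n * μ.real (Set.Icc a b) ≤ 1 := by
  have hfloor := monotone_floor_mul_measureReal_Iio μ n hab.le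
  have hceil := monotone_ceil_mul_measureReal_Iic μ n hab.le
  dsimp only at hfloor hceil
  unfold quantileCell at h
  have hfloor_eq : ⌊n * μ.real (Set.Iio a)⌋₊ = ⌊n * μ.real (Set.Iio b)⌋₊ := by lia
  have hceil_eq : ⌈n * μ.real (Set.Iic a)⌉₊ = ⌈n * μ.real (Set.Iic b)⌉₊ := by lia
  have hmass : n * μ.real (Set.Iic b) ≤ n * μ.real (Set.Iio a) + 1 := calc
    _ ≤ (⌈n * μ.real (Set.Iic a)⌉₊ : ℝ) := hceil_eq ▸ Nat.le_ceil _
    _ ≤ (⌈n * μ.real (Set.Iio b)⌉₊ : ℝ) := by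
      gcongr
      exact measure_ne_top _ _
    _ ≤ (⌊n * μ.real (Set.Iio b)⌋₊ : ℝ) + 1 := by
      exact_mod_cast Nat.ceil_le_floor_add_one _
    _ ≤ n * μ.real (Set.Iio a) + 1 := by
      rw [← hfloor_eq]
      gcongr
      exact Nat.floor_le (by positivity)
  have hIcc : μ.real (Set.Icc a b) = μ.real (Set.Iic b) - μ.real (Set.Iio a) := by
    rw [← measureReal_sdiff (Set.Iio_subset_Iic hab.le) measurableSet_Iio]
    congr 1
    ext t
    simp
  rw [hIcc, mul_sub]
  linarith

theorem mul_measureReal_quantileCell_preimage_le_one {μ : Measure ℝ} [IsFiniteMeasure μ] {n q : ℕ}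
    (h : (quantileCell μ n ⁻¹' {q}).Nontrivial) :
    n * μ.real (quantileCell μ n ⁻¹' {q}) ≤ 1 := by
  rcases n.eq_zero_or_pos with rfl | hn
  · simp
  have hn' : (0 : ℝ) < n := Nat.cast_pos.2 hn
  rw [← le_div_iff₀' hn']
  refine measureReal_le_of_forall_measureReal_Icc_le
    ((monotone_quantileCell μ n).measurable (measurableSet_singleton q)) h
    fun a ha b hb hab => (le_div_iff₀' hn').2 ?_
  exact mul_measureReal_Icc_le_one_of_quantileCell_eq hab (ha.trans hb.symm)

theorem exists_quantileCell_bracket (μ : Measure ℝ) [IsFiniteMeasure μ] (n : ℕ) (y : ℝ) :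
    ∃ a b : ℕ, (∀ x, quantileCell μ n x < a → x < y) ∧ (∀ x < y, quantileCell μ n x < b) ∧
      n * μ.real (quantileCell μ n ⁻¹' Set.Ico a b) ≤ 1 := by
  have hmono := monotone_quantileCell μ n
  rcases (quantileCell μ n ⁻¹' {quantileCell μ n y}).subsingleton_or_nontrivial with h | h
  · refine ⟨_, _, fun x => hmono.reflect_lt, fun x hx => (hmono hx.le).lt_of_ne fun hxy => ?_,
      by simp⟩
    exact hx.ne (h hxy rfl)
  · refine ⟨_, quantileCell μ n y + 1, fun x => hmono.reflect_lt,
      fun x hx => Nat.lt_succ_of_le (hmono hx.le), ?_⟩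
    rw [Set.Ico_add_one_right_eq_Icc, Set.Icc_self]
    exact mul_measureReal_quantileCell_preimage_le_one h

variable {Ω ι : Type*} [MeasurableSpace Ω] [Fintype ι]

theorem measureReal_forall_lt_le_add_sum {β : Type*} [LinearOrder β] (π : Measure Ω)
    [IsFiniteMeasure π] (Q : ι → Ω → β) (a b : ι → β) :
    π.real {ω | ∀ j, Q j ω < b j} ≤
      π.real {ω | ∀ j, Q j ω < a j} + ∑ j, π.real (Q j ⁻¹' Set.Ico (a j) (b j)) := by
  have hcover : {ω | ∀ j, Q j ω < b j} ⊆
      {ω | ∀ j, Q j ω < a j} ∪ ⋃ j, Q j ⁻¹' Set.Ico (a j) (b j) := fun ω hω => by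
    rw [Set.mem_union, or_iff_not_imp_left]
    intro h
    obtain ⟨j, hj⟩ := not_forall.1 h
    exact Set.mem_iUnion.2 ⟨j, not_lt.1 hj, hω j⟩
  refine (measureReal_mono hcover).trans ((measureReal_union_le _ _).trans ?_)
  gcongr
  exact measureReal_iUnion_fintype_le _

theorem exists_quantileCell_boxes (π : Measure Ω) [IsFiniteMeasure π] {X : ι → Ω → ℝ}
    (hX : ∀ j, Measurable (X j)) (n : ℕ) (y : ι → ℝ) :
    ∃ a b : ι → ℕ,
      (∀ ω, (∀ j, quantileCell (π.map (X j)) n (X j ω) < a j) → ∀ j, X j ω < y j) ∧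
      (∀ ω, (∀ j, X j ω < y j) → ∀ j, quantileCell (π.map (X j)) n (X j ω) < b j) ∧
      n * π.real {ω | ∀ j, quantileCell (π.map (X j)) n (X j ω) < b j} ≤
        n * π.real {ω | ∀ j, quantileCell (π.map (X j)) n (X j ω) < a j} + Fintype.card ι := by
  choose a b ha hb hab using fun j => exists_quantileCell_bracket (π.map (X j)) n (y j)
  refine ⟨a, b, fun ω h j => ha j _ (h j), fun ω h j => hb j _ (h j), ?_⟩
  let Q (j : ι) (ω : Ω) : ℕ := quantileCell (π.map (X j)) n (X j ω)
  have hsum : ∑ j, n * π.real (Q j ⁻¹' Set.Ico (a j) (b j)) ≤ Fintype.card ι := by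
    refine (Finset.sum_le_card_nsmul _ _ 1 fun j _ => (hab j).trans_eq' ?_).trans_eq (by simp)
    rw [map_measureReal_apply (hX j) ((monotone_quantileCell _ n).measurable measurableSet_Ico)]
    rfl
  have h := mul_le_mul_of_nonneg_left (measureReal_forall_lt_le_add_sum π Q a b)
    (n.cast_nonneg (α := ℝ))
  rw [mul_add, Finset.mul_sum] at h
  linarith

theorem exists_points_abs_card_sub_measureReal_le [Nonempty ι] (π : Measure Ω)
    [IsProbabilityMeasure π] {X : ι → Ω → ℝ} (hX : ∀ j, Measurable (X j)) (n : ℕ) :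
    ∃ f : Fin n → Ω, ∀ y : ι → ℝ,
      |(Finset.card {i | ∀ j, X j (f i) < y j} : ℝ) - n * π.real {ω | ∀ j, X j ω < y j}| ≤
        2 * √((2 + Nat.log 2 n) * Fintype.card ι : ℕ) *
          ((2 + Nat.log 2 n : ℕ) : ℝ) ^ Fintype.card ι + Fintype.card ι := by
  have hm : 2 * n + 1 < 2 ^ (2 + Nat.log 2 n) := by
    have := Nat.lt_pow_succ_log_self one_lt_two n
    rw [pow_succ] at this
    rw [pow_add]
    lia
  have hmap (j) : IsProbabilityMeasure (π.map (X j)) :=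
    Measure.isProbabilityMeasure_map (hX j).aemeasurable
  let Q (j : ι) (ω : Ω) : ℕ := quantileCell (π.map (X j)) n (X j ω)
  have hQ (j) : Measurable (Q j) := (monotone_quantileCell _ n).measurable.comp (hX j)
  let cell (ω : Ω) (j : ι) : Fin (2 * n + 1) := ⟨Q j ω, Nat.lt_succ_of_le (quantileCell_le _ _ _)⟩
  have hcell : Measurable cell := measurable_pi_iff.2 fun j => measurable_to_countable' fun q => by
    simpa [cell, Fin.ext_iff, Set.preimage] using hQ j (measurableSet_singleton (q : ℕ))
  obtain ⟨f, hf⟩ := exists_points_abs_card_cell_sub_measureReal_le π (by lia) hm hcell n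
  refine ⟨f, fun y => ?_⟩
  obtain ⟨a, b, hinner, houter, hmass⟩ := exists_quantileCell_boxes π hX n y
  have hmass_inner : n * π.real {ω | ∀ j, Q j ω < a j} ≤ n * π.real {ω | ∀ j, X j ω < y j} :=
    mul_le_mul_of_nonneg_left (measureReal_mono hinner) n.cast_nonneg
  have hmass_outer : n * π.real {ω | ∀ j, X j ω < y j} ≤ n * π.real {ω | ∀ j, Q j ω < b j} :=
    mul_le_mul_of_nonneg_left (measureReal_mono houter) n.cast_nonneg
  have hcount_inner : (Finset.card {i | ∀ j, Q j (f i) < a j} : ℝ) ≤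
      Finset.card {i | ∀ j, X j (f i) < y j} :=
    Nat.cast_le.2 (Finset.card_le_card (Finset.monotone_filter_right _ fun _ _ => hinner _))
  have hcount_outer : (Finset.card {i | ∀ j, X j (f i) < y j} : ℝ) ≤
      Finset.card {i | ∀ j, Q j (f i) < b j} :=
    Nat.cast_le.2 (Finset.card_le_card (Finset.monotone_filter_right _ fun _ _ => houter _))
  have ha' := abs_le.1 (hf a)
  have hb' := abs_le.1 (hf b)
  refine abs_le.2 ⟨?_, ?_⟩ <;> linarith

end QuantileCells

section StarDiscrepancy

theorem two_mul_sqrt_mul_pow_add_le (d : ℕ) {k : ℕ} {L : ℝ} (hkL : k ≤ L) (hL : 2 ≤ L) :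
    2 * √(k * d : ℕ) * (k : ℝ) ^ d + d ≤ 3 * √d * L ^ ((d : ℝ) + 1 / 2) := by
  have hrpow : L ^ ((d : ℝ) + 1 / 2) = √L * L ^ d := by
    rw [Real.rpow_add (by linarith), Real.rpow_natCast, ← Real.sqrt_eq_rpow, mul_comm]
  have hround : √(k * d : ℕ) * (k : ℝ) ^ d ≤ √d * (√L * L ^ d) := by
    rw [Nat.cast_mul, Real.sqrt_mul k.cast_nonneg, mul_comm √(k : ℝ), mul_assoc]
    gcongr
  have hsqrt : √d ≤ √L * L ^ d := calc
    √d ≤ d := Real.sqrt_le_iff.2 ⟨d.cast_nonneg, by exact_mod_cast Nat.le_self_pow two_ne_zero d⟩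
    _ ≤ 2 ^ d := by exact_mod_cast d.lt_two_pow_self.le
    _ ≤ L ^ d := by gcongr
    _ ≤ √L * L ^ d := le_mul_of_one_le_left (by positivity) (Real.one_le_sqrt.2 (by linarith))
  have hcells : (d : ℝ) ≤ √d * (√L * L ^ d) := calc
    (d : ℝ) = √d * √d := (Real.mul_self_sqrt d.cast_nonneg).symm
    _ ≤ √d * (√L * L ^ d) := by gcongr
  rw [hrpow]
  linarith

variable {d n : ℕ} {G : Set (Fin d → ℝ)} {π : Measure G}

theorem starDiscrepancy_anchoredBoxes_le_div (hn : n ≠ 0) {x : Fin n → G} {r : ℝ}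
    (h : ∀ y : Fin d → ℝ,
      |(Finset.card {i | ∀ j, (x i : Fin d → ℝ) j < y j} : ℝ) -
        n * π.real {g | ∀ j, (g : Fin d → ℝ) j < y j}| ≤ r) :
    starDiscrepancy (anchoredBoxes G) π x ≤ r / n := by
  classical
  have hn' : (0 : ℝ) < n := Nat.cast_pos.2 (Nat.pos_of_ne_zero hn)
  have : Nonempty (anchoredBoxes G) := ⟨⟨_, 0, rfl⟩⟩
  refine ciSup_le ?_
  rintro ⟨_, y, rfl⟩
  rw [le_div_iff₀ hn', ← abs_of_pos hn', ← abs_mul, abs_of_pos hn']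
  refine (congrArg _ ?_).trans_le (h y)
  rw [sub_mul, one_div_mul_eq_div, div_mul_cancel₀ _ hn'.ne', mul_comm (π.real _)]
  simp [Set.indicator_apply]

theorem exists_starDiscrepancy_anchoredBoxes_le (π : Measure G) [IsProbabilityMeasure π]
    (hn : n ≠ 0) : ∃ x : Fin n → G, starDiscrepancy (anchoredBoxes G) π x ≤
      3 * √d * (2 + Real.logb 2 n) ^ ((d : ℝ) + 1 / 2) / n := by
  have hlog : 0 ≤ Real.logb 2 n :=
    Real.logb_nonneg one_lt_two (Nat.one_le_cast.2 (Nat.one_le_iff_ne_zero.2 hn))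
  rcases isEmpty_or_nonempty (Fin d) with h | h
  · obtain ⟨g⟩ := nonempty_of_isProbabilityMeasure π
    exact ⟨fun _ => g, starDiscrepancy_anchoredBoxes_le_div hn fun y => by
      simpa using by positivity⟩
  · obtain ⟨x, hx⟩ := exists_points_abs_card_sub_measureReal_le π
      (X := fun j (g : G) => (g : Fin d → ℝ) j)
      (fun j => (measurable_pi_apply j).comp measurable_subtype_coe) n
    refine ⟨x, starDiscrepancy_anchoredBoxes_le_div hn fun y => ?_⟩
    -- `congr!` because `∀ j : Fin d, _` and `∀ j : ι, _` are decided by different instances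
    refine (Eq.trans_le (by congr!) (hx y)).trans ?_
    rw [Fintype.card_fin]
    refine two_mul_sqrt_mul_pow_add_le d ?_ (by linarith)
    push_cast
    gcongr
    exact Real.natLog_le_logb n 2

theorem three_mul_sqrt_mul_rpow_le (d : ℕ) {L : ℝ} (hL : 1 ≤ L) :
    3 * √d * L ^ ((d : ℝ) + 1 / 2) ≤ 63 * √d * L ^ ((3 * (d : ℝ) + 1) / 2) := by
  gcongr
  · norm_num
  · linarith [d.cast_nonneg (α := ℝ)]

end StarDiscrepancy

theorem drivenPoints_surjective {G : Type*} {s n : ℕ} {φ : G → UnitCube s → G}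
    (hφ : AnywhereToAnywhere φ) {ψ : UnitCube s → G} (hψ : Function.Surjective ψ) :
    Function.Surjective fun u : Fin n → UnitCube s => drivenPoints φ ψ u := by
  intro x
  choose v hv using hψ
  choose w hw using hφ
  refine ⟨fun i => if h : i.1 = 0 then v (x i) else w (x ⟨i.1 - 1, by lia⟩) (x i), ?_⟩
  funext ⟨i, hi⟩
  simp only [drivenPoints]
  induction i with
  | zero => simp [drivenState, hv]
  | succ i ih =>
    rw [drivenState, ih (by lia)]
    simp [hw]

theorem mainTheorem7_general {d s : ℕ} (G : Set (Fin d → ℝ)) (π : Measure G)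
    [IsProbabilityMeasure π] (φ : G → UnitCube s → G) (hφ : AnywhereToAnywhere φ)
    (ψ : UnitCube s → G) (hψ : Function.Surjective ψ) (n : ℕ) (hn : n ≠ 0) :
    ∃ u : Fin n → UnitCube s,
      starDiscrepancy (anchoredBoxes G) π (drivenPoints φ ψ u) ≤
        3 * √d * (2 + Real.logb 2 n) ^ ((d : ℝ) + 1 / 2) / n := by
  obtain ⟨x, hx⟩ := exists_starDiscrepancy_anchoredBoxes_le π hn
  obtain ⟨u, rfl⟩ := drivenPoints_surjective hφ hψ x
  exact ⟨u, hx⟩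

theorem mainTheorem7 {d s : ℕ} (G : Set (Fin d → ℝ)) (hGb : Bornology.IsBounded G)
    (hGm : MeasurableSet G) (π : Measure G) [IsProbabilityMeasure π]
    (K : Kernel G G) [IsMarkovKernel K]
    (φ : G → UnitCube s → G) (hφ : IsUpdateFunction K φ) (hφ' : AnywhereToAnywhere φ)
    (ψ : UnitCube s → G) (hψ : Function.Surjective ψ) (n : ℕ) (hn : 1 ≤ n) :
    ∃ u : Fin n → UnitCube s,
      starDiscrepancy (anchoredBoxes G) π (drivenPoints φ ψ u) ≤
        63 * Real.sqrt d * ((2 + Real.logb 2 n) ^ ((3 * (d : ℝ) + 1) / 2) / n) := by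
  have hL : 1 ≤ 2 + Real.logb 2 n := by
    linarith [Real.logb_nonneg one_lt_two (Nat.one_le_cast.2 hn)]
  obtain ⟨u, hu⟩ := mainTheorem7_general G π φ hφ' ψ hψ n (Nat.one_le_iff_ne_zero.1 hn)
  refine ⟨u, hu.trans ?_⟩
  rw [← mul_div_assoc]
  exact div_le_div_of_nonneg_right (three_mul_sqrt_mul_rpow_le d hL) n.cast_nonneg
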